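/- \textbf{Index terms.} Let $\Theta$ be a signature of function symbols with arities, containing the constants $0,1$ and the binary symbols $+,\dot-$. Index terms are $I,J,K ::= a \mid f(I_1,\dots,I_n) \mid \sum_{a<I}J \mid \triangle_a^{I,J}K$, where $a$ ranges over index variables and is bound in $J$, respectively in $K$. Let $\mathcal E$ be a set of equations between index terms. Fix an interpretation of the symbols by partial functions on $\mathbb N$ which gives $0,1,+$ and truncated subtraction $\dot-$ their usual meaning and satisfies $\mathcal E$ (for every assignment the two sides of each equation are both undefined, or both defined and equal). For an assignment $\rho$ of naturals to the variables, $[\![I]\!]_\rho$ is the resulting partial value. All constructs are strict; $\sum_{a<I}J$ is the sum of the values of $J$ for $a=0,\dots,[\![I]\!]_\rho-1$; and $\triangle_a^{I,J}K$ is the number of nodes of the forest of $J$ trees numbered in pre-order from $I$ on, in which node $a$ has $K$ children: $\triangle_a^{I,0}K=0$ and $\triangle_a^{I,J+1}K=N+1+\triangle_a^{I+1+N,\,K\{I+N/a\}}K$ with $N=\triangle_a^{I,J}K$, undefined if the forest is infinite. A constraint $I\le J$ is true under $\rho$ if both sides are defined and the first is at most the second ($I<J$ means $I+1\le J$). For a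 finite set $\phi$ of index variables and a finite set $\Phi$ of constraints over $\phi$, write $\phi;\Phi\models I\le J$ if $I\le J$ is true under every assignment to $\phi$ that makes all of $\Phi$ true. \textbf{Types.} Linear types are $A,B::=\sigma\multimap\tau$; modal types are $\sigma,\tau::=[a<I]A\mid \mathsf{Nat}[I,J]$, with $a$ bound in $A$; types are taken up to renaming of bound index variables. The partial operation $\uplus$ is given by $[a<I]A\{a/c\}\uplus[b<J]A\{I+b/c\}=[c<I+J]A$ and $\mathsf{Nat}[I,J]\uplus\mathsf{Nat}[I,J]=\mathsf{Nat}[I,J]$. The partial operation $\sum_{a<I}$ is given by $\sum_{a<I}[b<J]A\{b+\sum_{d<a}J\{d/a\}/c\}=[c<\sum_{a<I}J]A$ ($a$ not free in $A$) and $\sum_{a<I}\mathsf{Nat}[J,K]=\mathsf{Nat}[J,K]$ ($a$ not free in $J,K$). Both extend pointwise to contexts $\Gamma,\Delta$ (partial maps from term variables to modal types); a variable declared in only one of $\Gamma,\Delta$ keeps its type in $\Gamma\uplus\Delta$. Subtyping $\phi;\Phi\vdash\cdot\sqsubseteq\cdot$ is generated by: $\mathsf{Nat}[I,J]\sqsubseteq\mathsf{Nat}[K,H]$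 if $\phi;\Phi\models K\le I$ and $\phi;\Phi\models J\le H$; $\sigma\multimap\tau\sqsubseteq\sigma'\multimap\tau'$ if $\sigma'\sqsubseteq\sigma$ and $\tau\sqsubseteq\tau'$; $[a<I]A\sqsubseteq[a<J]B$ if $a,\phi;a<J,\Phi\vdash A\sqsubseteq B$ and $\phi;\Phi\models J\le I$. $\Delta\sqsubseteq\Gamma$ means that every variable $x$ declared in $\Gamma$ is declared in $\Delta$ and $\Delta(x)\sqsubseteq\Gamma(x)$. \textbf{Terms and typing.} Values are $v::=\underline n\mid\lambda x.t\mid\mathsf{fix}\,x.t$; terms are $t,u,s::=x\mid v\mid tu\mid \mathsf s(t)\mid\mathsf p(t)\mid\mathsf{ifz}\ t\ \mathsf{then}\ u\ \mathsf{else}\ s$. The size is $|x|=|\underline n|=2$, $|\lambda x.t|=|\mathsf{fix}\,x.t|=|\mathsf s(t)|=|\mathsf p(t)|=|t|+2$, $|tu|=|t|+|u|+2$, $|\mathsf{ifz}\ t\ \mathsf{then}\ u\ \mathsf{else}\ s|=|t|+|u|+|s|+2$. The system $\mathsf{d}\ell\mathsf{PCF_V}$ derives judgements $\phi;\Phi;\Gamma\vdash_K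 t:\tau$, where the index term $K$ is the weight, by the rules below (unless shown otherwise, premises have the same $\phi;\Phi$ as the conclusion; bound index variables are chosen not in $\phi$). \begin{itemize} \item $\Gamma,x:\sigma\vdash_0x:\sigma$, and $\Gamma\vdash_0\underline n:\mathsf{Nat}[n,n]$. \item If $\Gamma\vdash_It:\sigma$, $\Delta\sqsubseteq\Gamma$, $\sigma\sqsubseteq\tau$ and $\phi;\Phi\models I\le J$, then $\Delta\vdash_Jt:\tau$. \item If $a,\phi;a<I,\Phi;\Gamma,x:\sigma\vdash_Kt:\tau$, then $\sum_{a<I}\Gamma\vdash_{I+\sum_{a<I}K}\lambda x.t:[a<I](\sigma\multimap\tau)$. \item If $\Gamma\vdash_Kt:[a<1](\sigma\multimap\tau)$ and $\Delta\vdash_Hu:\sigma\{0/a\}$, then $\Gamma\uplus\Delta\vdash_{K+H}tu:\tau\{0/a\}$. \item If $\Gamma\vdash_Mt:\mathsf{Nat}[J,K]$, $\phi;J\le0,\Phi;\Delta\vdash_Nu:\tau$ and $\phi;1\le K,\Phi;\Delta\vdash_Ns:\tau$, then $\Gamma\uplus\Delta\vdash_{M+N}\mathsf{ifz}\ t\ \mathsf{then}\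 u\ \mathsf{else}\ s:\tau$. \item If $\Gamma\vdash_Mt:\mathsf{Nat}[I,J]$, then $\Gamma\vdash_M\mathsf s(t):\mathsf{Nat}[I+1,J+1]$ and $\Gamma\vdash_M\mathsf p(t):\mathsf{Nat}[I\dot-1,J\dot-1]$. \item Let $H=\triangle_b^{0,K}I$. If $b,\phi;b<H,\Phi;\Gamma,x:[a<I]A\vdash_Jt:[a<1]B$ and $a,b,\phi;a<I,b<H,\Phi\vdash B\{0/a\}\{\triangle_b^{b+1,a}I+b+1/b\}\sqsubseteq A$, then $\sum_{b<H}\Gamma\vdash_{H+\sum_{b<H}J}\mathsf{fix}\,x.t:[a<K]B\{0/a\}\{\triangle_b^{0,a}I/b\}$. \end{itemize} \textbf{CEK machine.} A closure $\langle t;\xi\rangle$ is a term with an environment; an environment $\xi$ is a list $(x_1\mapsto V_1)\cdot(x_2\mapsto V_2)\cdots$ of assignments of value closures (closures $\langle v;\xi\rangle$ of values) to variables, and $\xi(x)$ is the first value closure assigned to $x$. Stacks are $\pi::=\diamond\mid\mathsf{fun}(V,\pi)\mid\mathsf{arg}(C,\pi)\mid\mathsf{fork}(t,u,\xi,\pi)\mid\mathsf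 s(\pi)\mid\mathsf p(\pi)$, with $V$ a value closure and $C$ a closure. The transitions are \begin{align*} V\star\mathsf{arg}(C,\pi)&\succ C\star\mathsf{fun}(V,\pi)\\ V\star\mathsf{fun}(\langle\lambda x.t;\xi\rangle,\pi)&\succ\langle t;(x\mapsto V)\cdot\xi\rangle\star\pi\\ V\star\mathsf{fun}(\langle\mathsf{fix}\,x.t;\xi\rangle,\pi)&\succ\langle t;(x\mapsto\langle\mathsf{fix}\,x.t;\xi\rangle)\cdot\xi\rangle\star\mathsf{arg}(V,\pi)\\ \langle\underline0;\xi'\rangle\star\mathsf{fork}(t,u,\xi,\pi)&\succ\langle t;\xi\rangle\star\pi\\ \langle\underline{n+1};\xi'\rangle\star\mathsf{fork}(t,u,\xi,\pi)&\succ\langle u;\xi\rangle\star\pi\\ \langle\underline n;\xi\rangle\star\mathsf s(\pi)&\succ\langle\underline{n+1};\emptyset\rangle\star\pi\\ \langle\underline n;\xi\rangle\star\mathsf p(\pi)&\succ\langle\underline{n\dot-1};\emptyset\rangle\star\pi\\ \langle x;\xi\rangle\star\pi&\succ\xi(x)\star\pi\\ \langle tu;\xi\rangle\star\pi&\succ\langle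 t;\xi\rangle\star\mathsf{arg}(\langle u;\xi\rangle,\pi)\\ \langle\mathsf s(t);\xi\rangle\star\pi&\succ\langle t;\xi\rangle\star\mathsf s(\pi)\\ \langle\mathsf p(t);\xi\rangle\star\pi&\succ\langle t;\xi\rangle\star\mathsf p(\pi)\\ \langle\mathsf{ifz}\ t\ \mathsf{then}\ u\ \mathsf{else}\ s;\xi\rangle\star\pi&\succ\langle t;\xi\rangle\star\mathsf{fork}(u,s,\xi,\pi). \end{align*} Write $t\Downarrow^n m$ if $\langle t;\emptyset\rangle\star\diamond$ reaches $\langle\underline m;\xi\rangle\star\diamond$ in exactly $n$ transitions, for some environment $\xi$. \textbf{Theorem (Intensional soundness).} Let $t$ be a term and let $H,I,J$ be closed index terms such that $\emptyset;\emptyset;\emptyset\vdash_Ht:\mathsf{Nat}[I,J]$ is derivable and $[\![H]\!]$ is defined. Then $[\![I]\!]$ and $[\![J]\!]$ are defined, and there are natural numbers $n,m$ with $t\Downarrow^nm$, $n\le|t|\cdot([\![H]\!]+1)$ and $[\![I]\!]\le m\le[\![J]\!]$. -/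

import Mathlib

namespace DLPCF

universe u

/-! ### Index terms -/

/-- The part of an index signature that lies beyond the symbols `0`, `1`, `+`, `∸`. The latter
belong to every signature and are always read in the usual way, so they are separate constructors
of `Idx` below. -/
structure Signature where
  Sym : Type u
  arity : Sym → ℕ

/-- Index terms with free index variables among `φ` many (well-scoped de Bruijn indices: variable
`0` is the most recently bound one). `sum I J` is the bounded sum `∑_{a<I} J` and
`forest I J K` is the cardinality of the forest of `J` trees described by `K` and numbered in
pre-order from `I` on. The variable `a` is bound in `J`, respectively in `K`. -/
inductive Idx (Θ : Signature.{u}) : ℕ → Type u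
  | var {φ : ℕ} (a : Fin φ) : Idx Θ φ
  | zero {φ : ℕ} : Idx Θ φ
  | one {φ : ℕ} : Idx Θ φ
  | add {φ : ℕ} (I J : Idx Θ φ) : Idx Θ φ
  | monus {φ : ℕ} (I J : Idx Θ φ) : Idx Θ φ
  | app {φ : ℕ} (f : Θ.Sym) (args : Fin (Θ.arity f) → Idx Θ φ) : Idx Θ φ
  | sum {φ : ℕ} (I : Idx Θ φ) (J : Idx Θ (φ + 1)) : Idx Θ φ
  | forest {φ : ℕ} (I J : Idx Θ φ) (K : Idx Θ (φ + 1)) : Idx Θ φ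

/-- Extension of a renaming of variables under a binder. -/
def liftRen {φ ψ : ℕ} (r : Fin φ → Fin ψ) : Fin (φ + 1) → Fin (ψ + 1) :=
  Fin.cases 0 (fun i => (r i).succ)

namespace Idx

variable {Θ : Signature.{u}}

/-- Renaming of index variables. -/
def rename {φ ψ : ℕ} (r : Fin φ → Fin ψ) : Idx Θ φ → Idx Θ ψ
  | var a => var (r a)
  | zero => zero
  | one => one
  | add I J => add (I.rename r) (J.rename r)
  | monus I J => monus (I.rename r) (J.rename r)
  | app f args => app f (fun i => (args i).rename r)
  | sum I J => sum (I.rename r) (J.rename (liftRen r))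
  | forest I J K => forest (I.rename r) (J.rename r) (K.rename (liftRen r))

/-- Weakening by one new index variable. -/
def wk {φ : ℕ} (I : Idx Θ φ) : Idx Θ (φ + 1) := I.rename Fin.succ

/-- Extension of a substitution under a binder. -/
def up {φ ψ : ℕ} (s : Fin φ → Idx Θ ψ) : Fin (φ + 1) → Idx Θ (ψ + 1) :=
  Fin.cases (var 0) (fun i => (s i).wk)

/-- Simultaneous capture-avoiding substitution of index terms for index variables. -/
def subst {φ ψ : ℕ} (s : Fin φ → Idx Θ ψ) : Idx Θ φ → Idx Θ ψ
  | var a => s a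
  | zero => zero
  | one => one
  | add I J => add (I.subst s) (J.subst s)
  | monus I J => monus (I.subst s) (J.subst s)
  | app f args => app f (fun i => (args i).subst s)
  | sum I J => sum (I.subst s) (J.subst (up s))
  | forest I J K => forest (I.subst s) (J.subst s) (K.subst (up s))

/-- The index term `1 + 1 + ⋯ + 1` with `n` summands. -/
def num {φ : ℕ} : ℕ → Idx Θ φ
  | 0 => zero
  | 1 => one
  | n + 2 => add (num (n + 1)) one

end Idx

/-- An interpretation of the symbols of a signature as partial functions on the natural
numbers. -/
def Interp (Θ : Signature.{u}) : Type u :=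
  (f : Θ.Sym) → (Fin (Θ.arity f) → ℕ) → Part ℕ

/-- `Forest k i j n`: the forest of `j` trees, numbered in pre-order from `i` on, in which node `v`
has `k v` children, is finite and has exactly `n` nodes. These are the two recursive equations of
forest cardinalities; infinite forests have no cardinality. -/
inductive Forest (k : ℕ → Part ℕ) : ℕ → ℕ → ℕ → Prop
  | zero (i : ℕ) : Forest k i 0 0
  | succ {i j x c y : ℕ} (trees : Forest k i j x) (children : c ∈ k (i + x))
      (subtrees : Forest k (i + 1 + x) c y) : Forest k i (j + 1) (x + 1 + y)

theorem Forest.unique {k : ℕ → Part ℕ} {i j x : ℕ} (h : Forest k i j x) :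
    ∀ {y : ℕ}, Forest k i j y → x = y := by
  induction h with
  | zero i => intro y hy; cases hy; rfl
  | succ _ hc _ ih₁ ih₂ =>
    intro y hy
    cases hy with
    | succ h₁ hc' h₂ =>
      obtain rfl := ih₁ h₁
      obtain rfl := Part.mem_unique hc hc'
      rw [ih₂ h₂]

/-- The cardinality of a forest, as a partial value. -/
noncomputable def forestCard (k : ℕ → Part ℕ) (i j : ℕ) : Part ℕ :=
  ⟨∃ n, Forest k i j n, fun h => h.choose⟩

theorem mem_forestCard {k : ℕ → Part ℕ} {i j n : ℕ} :
    n ∈ forestCard k i j ↔ Forest k i j n :=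
  ⟨fun ⟨h, e⟩ => e ▸ h.choose_spec, fun h => ⟨⟨n, h⟩, (Exists.choose_spec ⟨n, h⟩).unique h⟩⟩

/-- `f 0 + ⋯ + f (n - 1)`, defined if and only if all summands are. -/
def boundedSum (f : ℕ → Part ℕ) : ℕ → Part ℕ
  | 0 => Part.some 0
  | n + 1 => (boundedSum f n).bind fun x => (f n).map fun y => x + y

/-- The partial meaning of an index term under an interpretation of the symbols and an assignment
`ρ` of natural numbers to the variables. All constructs are strict. -/
noncomputable def Idx.eval {Θ : Signature.{u}} (S : Interp Θ) {φ : ℕ} :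
    Idx Θ φ → (Fin φ → ℕ) → Part ℕ
  | .var a, ρ => Part.some (ρ a)
  | .zero, _ => Part.some 0
  | .one, _ => Part.some 1
  | .add I J, ρ => (I.eval S ρ).bind fun x => (J.eval S ρ).map fun y => x + y
  | .monus I J, ρ => (I.eval S ρ).bind fun x => (J.eval S ρ).map fun y => x - y
  | .app f args, ρ =>
      (⟨∀ i, ((args i).eval S ρ).Dom, fun h i => ((args i).eval S ρ).get (h i)⟩ :
        Part (Fin (Θ.arity f) → ℕ)).bind (S f)
  | .sum I J, ρ => (I.eval S ρ).bind fun n => boundedSum (fun a => J.eval S (Fin.cons a ρ)) n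
  | .forest I J K, ρ =>
      (I.eval S ρ).bind fun i => (J.eval S ρ).bind fun j =>
        forestCard (fun a => K.eval S (Fin.cons a ρ)) i j

/-- An equational program: a set of equations between index terms. -/
abbrev EqProgram (Θ : Signature.{u}) : Type u := Set (Σ φ : ℕ, Idx Θ φ × Idx Θ φ)

/-- The interpretation `S` is a model of the equational program `E`: under every assignment, the
two sides of each equation are both undefined, or both defined and equal. -/
def Interp.Models {Θ : Signature.{u}} (S : Interp Θ) (E : EqProgram Θ) : Prop :=
  ∀ (φ : ℕ) (I J : Idx Θ φ), (⟨φ, I, J⟩ : Σ φ : ℕ, Idx Θ φ × Idx Θ φ) ∈ E →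
    ∀ ρ : Fin φ → ℕ, I.eval S ρ = J.eval S ρ

/-- The constraint `lhs ≤ rhs`. -/
structure Constraint (Θ : Signature.{u}) (φ : ℕ) where
  lhs : Idx Θ φ
  rhs : Idx Θ φ

namespace Constraint

variable {Θ : Signature.{u}}

/-- The constraint `I < J`, that is, `I + 1 ≤ J`. -/
def lt {φ : ℕ} (I J : Idx Θ φ) : Constraint Θ φ := ⟨.add I .one, J⟩

/-- A constraint is true if both sides are defined and the first is at most the second. -/
def Holds {φ : ℕ} (S : Interp Θ) (c : Constraint Θ φ) (ρ : Fin φ → ℕ) : Prop :=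
  ∃ x ∈ c.lhs.eval S ρ, ∃ y ∈ c.rhs.eval S ρ, x ≤ y

def wk {φ : ℕ} (c : Constraint Θ φ) : Constraint Θ (φ + 1) := ⟨c.lhs.wk, c.rhs.wk⟩

end Constraint

/-- Index contexts: finite sets of constraints. -/
abbrev ICtx (Θ : Signature.{u}) (φ : ℕ) : Type u := List (Constraint Θ φ)

def ICtx.wk {Θ : Signature.{u}} {φ : ℕ} (Φ : ICtx Θ φ) : ICtx Θ (φ + 1) :=
  List.map Constraint.wk Φ

/-- The judgement `φ; Φ ⊨ I ≤ J`: the inequality follows semantically from `Φ`. -/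
def Entails {Θ : Signature.{u}} (S : Interp Θ) {φ : ℕ} (Φ : ICtx Θ φ) (I J : Idx Θ φ) : Prop :=
  ∀ ρ : Fin φ → ℕ, (∀ c ∈ Φ, c.Holds S ρ) → (Constraint.mk I J).Holds S ρ

/-! ### Types -/

inductive Kind
  | linear
  | modal

/-- Linear types `σ ⊸ τ` and modal types `[a < I] A` and `Nat[I, J]`, with free index variables
among `φ` many; in `bang I A` the variable `0` of `A` is the bound variable `a`. -/
inductive Ty (Θ : Signature.{u}) : Kind → ℕ → Type u
  | arrow {φ : ℕ} (σ τ : Ty Θ .modal φ) : Ty Θ .linear φ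
  | bang {φ : ℕ} (I : Idx Θ φ) (A : Ty Θ .linear (φ + 1)) : Ty Θ .modal φ
  | nat {φ : ℕ} (I J : Idx Θ φ) : Ty Θ .modal φ

abbrev LinTy (Θ : Signature.{u}) (φ : ℕ) : Type u := Ty Θ .linear φ
abbrev ModTy (Θ : Signature.{u}) (φ : ℕ) : Type u := Ty Θ .modal φ

namespace Ty

variable {Θ : Signature.{u}}

/-- Substitution of index terms for the index variables of a type. -/
def subst {φ ψ : ℕ} (s : Fin φ → Idx Θ ψ) : {k : Kind} → Ty Θ k φ → Ty Θ k ψ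
  | _, arrow σ τ => arrow (σ.subst s) (τ.subst s)
  | _, bang I A => bang (I.subst s) (A.subst (Idx.up s))
  | _, nat I J => nat (I.subst s) (J.subst s)

/-- `A{I/a}` for the variable `a` with index `0`. -/
def inst {k : Kind} {φ : ℕ} (A : Ty Θ k (φ + 1)) (I : Idx Θ φ) : Ty Θ k φ :=
  A.subst (Fin.cases I Idx.var)

/-- `IsSum σ τ υ` says that `σ ⊎ τ` exists and is `υ`: the sum of `[a < I] A{a/c}` and
`[b < J] A{I + b/c}` is `[c < I + J] A`, and `Nat[I, J] ⊎ Nat[I, J]` is `Nat[I, J]`. -/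
inductive IsSum {φ : ℕ} : ModTy Θ φ → ModTy Θ φ → ModTy Θ φ → Prop
  | bang (I J : Idx Θ φ) (A : LinTy Θ (φ + 1)) :
      IsSum (bang I A)
        (bang J (A.subst (Fin.cases (.add I.wk (.var 0)) (fun i => .var i.succ))))
        (bang (.add I J) A)
  | nat (I J : Idx Θ φ) : IsSum (nat I J) (nat I J) (nat I J)

/-- `IsBoundedSum I σ υ` says that `∑_{a<I} σ` exists and is `υ`, where `a` is the variable `0` of
`σ`: for `σ = [b < J] A{b + ∑_{d<a} J{d/a} / c}` with `a` not free in `A` it is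
`[c < ∑_{a<I} J] A`, and for `σ = Nat[J, K]` with `a` not free in `J`, `K` it is `Nat[J, K]`. -/
inductive IsBoundedSum {φ : ℕ} (I : Idx Θ φ) : ModTy Θ (φ + 1) → ModTy Θ φ → Prop
  | bang (J : Idx Θ (φ + 1)) (A : LinTy Θ (φ + 1)) :
      IsBoundedSum I
        (bang J (A.subst (Fin.cases
          (.add (.var 0) (.sum (.var 1) (J.rename (liftRen fun i => i.succ.succ))))
          (fun i => .var i.succ.succ))))
        (bang (.sum I J) A)
  | nat (J K : Idx Θ φ) : IsBoundedSum I (nat J.wk K.wk) (nat J K)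

end Ty

/-- The subtyping judgement `φ; Φ ⊢ A ⊑ B`, on linear and on modal types. -/
inductive SubTy {Θ : Signature.{u}} (S : Interp Θ) :
    {φ : ℕ} → ICtx Θ φ → {k : Kind} → Ty Θ k φ → Ty Θ k φ → Prop
  | nat {φ : ℕ} {Φ : ICtx Θ φ} {I J K H : Idx Θ φ}
      (hl : Entails S Φ K I) (hr : Entails S Φ J H) :
      SubTy S Φ (Ty.nat I J) (Ty.nat K H)
  | arrow {φ : ℕ} {Φ : ICtx Θ φ} {σ τ σ' τ' : ModTy Θ φ}
      (hσ : SubTy S Φ σ' σ) (hτ : SubTy S Φ τ τ') :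
      SubTy S Φ (Ty.arrow σ τ) (Ty.arrow σ' τ')
  | bang {φ : ℕ} {Φ : ICtx Θ φ} {I J : Idx Θ φ} {A B : LinTy Θ (φ + 1)}
      (hA : SubTy S (.lt (.var 0) J.wk :: Φ.wk) A B) (hI : Entails S Φ J I) :
      SubTy S Φ (Ty.bang I A) (Ty.bang J B)

/-! ### Programs -/

/-- Names of term variables. -/
abbrev Var : Type := ℕ

/-- Terms. The values are the numerals `num n`, the abstractions `lam x t` and the fixpoints
`fix x t`; in `ifz t u s` the term `u` is the branch for zero. -/
inductive Tm
  | var (x : Var)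
  | num (n : ℕ)
  | lam (x : Var) (t : Tm)
  | fix (x : Var) (t : Tm)
  | app (t u : Tm)
  | succ (t : Tm)
  | pred (t : Tm)
  | ifz (t u s : Tm)

/-- The syntactic size `|t|` of a term. -/
def Tm.size : Tm → ℕ
  | .var _ => 2
  | .num _ => 2
  | .lam _ t => t.size + 2
  | .fix _ t => t.size + 2
  | .app t u => t.size + u.size + 2
  | .succ t => t.size + 2
  | .pred t => t.size + 2
  | .ifz t u s => t.size + u.size + s.size + 2

inductive Val
  | num (n : ℕ)
  | lam (x : Var) (t : Tm)
  | fix (x : Var) (t : Tm)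

def Val.toTm : Val → Tm
  | .num n => .num n
  | .lam x t => .lam x t
  | .fix x t => .fix x t

/-! ### The type system -/

/-- Typing contexts: partial maps from term variables to modal types. -/
abbrev Ctx (Θ : Signature.{u}) (φ : ℕ) : Type u := Var → Option (ModTy Θ φ)

namespace Ctx

variable {Θ : Signature.{u}}

def empty {φ : ℕ} : Ctx Θ φ := fun _ => none

/-- The context `Γ, x : σ`. -/
def extend {φ : ℕ} (Γ : Ctx Θ φ) (x : Var) (σ : ModTy Θ φ) : Ctx Θ φ :=
  Function.update Γ x (some σ)

/-- `IsSum Γ Δ Ξ` says that `Γ ⊎ Δ` exists and is `Ξ`; a variable that is declared in only one of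
`Γ` and `Δ` keeps its type. -/
def IsSum {φ : ℕ} (Γ Δ Ξ : Ctx Θ φ) : Prop :=
  ∀ x, match Γ x, Δ x with
    | none, none => Ξ x = none
    | some σ, none => Ξ x = some σ
    | none, some τ => Ξ x = some τ
    | some σ, some τ => ∃ υ, Ty.IsSum σ τ υ ∧ Ξ x = some υ

/-- `IsBoundedSum I Γ Ξ` says that `∑_{a<I} Γ` exists and is `Ξ`. -/
def IsBoundedSum {φ : ℕ} (I : Idx Θ φ) (Γ : Ctx Θ (φ + 1)) (Ξ : Ctx Θ φ) : Prop :=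
  ∀ x, match Γ x with
    | none => Ξ x = none
    | some σ => ∃ υ, Ty.IsBoundedSum I σ υ ∧ Ξ x = some υ

/-- `Δ ⊑ Γ`, pointwise. -/
def Sub {φ : ℕ} (S : Interp Θ) (Φ : ICtx Θ φ) (Δ Γ : Ctx Θ φ) : Prop :=
  ∀ x σ, Γ x = some σ → ∃ δ, Δ x = some δ ∧ SubTy S Φ δ σ

end Ctx

/-- The typing judgement `φ; Φ; Γ ⊢_K t : τ`, where `K` is the weight. In rule `fix` the variable
`b` is the variable `0` of `Γ`, `I`, `J` and the variable `1` of `A` and `B`, whose variable `0` is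
`a`. -/
inductive HasType {Θ : Signature.{u}} (S : Interp Θ) :
    {φ : ℕ} → ICtx Θ φ → Ctx Θ φ → Idx Θ φ → Tm → ModTy Θ φ → Prop
  | ax {φ : ℕ} {Φ : ICtx Θ φ} {Γ : Ctx Θ φ} {x : Var} {σ : ModTy Θ φ}
      (hx : Γ x = some σ) :
      HasType S Φ Γ .zero (.var x) σ
  | subs {φ : ℕ} {Φ : ICtx Θ φ} {Γ Δ : Ctx Θ φ} {I J : Idx Θ φ} {t : Tm} {σ τ : ModTy Θ φ}
      (ht : HasType S Φ Γ I t σ) (hΓ : Ctx.Sub S Φ Δ Γ) (hσ : SubTy S Φ σ τ)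
      (hI : Entails S Φ I J) :
      HasType S Φ Δ J t τ
  | lam {φ : ℕ} {Φ : ICtx Θ φ} {Γ : Ctx Θ (φ + 1)} {Ξ : Ctx Θ φ} {I : Idx Θ φ}
      {K : Idx Θ (φ + 1)} {x : Var} {t : Tm} {σ τ : ModTy Θ (φ + 1)}
      (ht : HasType S (.lt (.var 0) I.wk :: Φ.wk) (Γ.extend x σ) K t τ)
      (hΞ : Ctx.IsBoundedSum I Γ Ξ) :
      HasType S Φ Ξ (.add I (.sum I K)) (.lam x t) (.bang I (.arrow σ τ))
  | app {φ : ℕ} {Φ : ICtx Θ φ} {Γ Δ Ξ : Ctx Θ φ} {K H : Idx Θ φ} {t u : Tm}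
      {σ τ : ModTy Θ (φ + 1)}
      (ht : HasType S Φ Γ K t (.bang .one (.arrow σ τ)))
      (hu : HasType S Φ Δ H u (σ.inst .zero)) (hΞ : Ctx.IsSum Γ Δ Ξ) :
      HasType S Φ Ξ (.add K H) (.app t u) (τ.inst .zero)
  | ifz {φ : ℕ} {Φ : ICtx Θ φ} {Γ Δ Ξ : Ctx Θ φ} {M N J K : Idx Θ φ} {t u s : Tm}
      {τ : ModTy Θ φ}
      (ht : HasType S Φ Γ M t (.nat J K))
      (hu : HasType S (⟨J, .zero⟩ :: Φ) Δ N u τ)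
      (hs : HasType S (⟨.one, K⟩ :: Φ) Δ N s τ) (hΞ : Ctx.IsSum Γ Δ Ξ) :
      HasType S Φ Ξ (.add M N) (.ifz t u s) τ
  | num {φ : ℕ} {Φ : ICtx Θ φ} {Γ : Ctx Θ φ} {n : ℕ} :
      HasType S Φ Γ .zero (.num n) (.nat (.num n) (.num n))
  | succ {φ : ℕ} {Φ : ICtx Θ φ} {Γ : Ctx Θ φ} {M I J : Idx Θ φ} {t : Tm}
      (ht : HasType S Φ Γ M t (.nat I J)) :
      HasType S Φ Γ M (.succ t) (.nat (.add I .one) (.add J .one))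
  | pred {φ : ℕ} {Φ : ICtx Θ φ} {Γ : Ctx Θ φ} {M I J : Idx Θ φ} {t : Tm}
      (ht : HasType S Φ Γ M t (.nat I J)) :
      HasType S Φ Γ M (.pred t) (.nat (.monus I .one) (.monus J .one))
  | fix {φ : ℕ} {Φ : ICtx Θ φ} {Γ : Ctx Θ (φ + 1)} {Ξ : Ctx Θ φ} {K H : Idx Θ φ}
      {I J : Idx Θ (φ + 1)} {A B : LinTy Θ (φ + 2)} {x : Var} {t : Tm}
      -- `H` is the number of nodes of the forest of `K` trees of recursive calls
      (hH : H = .forest .zero K I)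
      (ht : HasType S (.lt (.var 0) H.wk :: Φ.wk) (Γ.extend x (.bang I A)) J t (.bang .one B))
      -- `B{0/a}{b + 1 + (forest of `a` trees from `b + 1` on) / b} ⊑ A`
      (hB : SubTy S (.lt (.var 0) I.wk :: .lt (.var 1) H.wk.wk :: Φ.wk.wk)
        ((B.inst .zero).subst (Fin.cases
          (.add (.add
            (.forest (.add (.var 1) .one) (.var 0) (I.rename (liftRen fun i => i.succ.succ)))
            (.var 1)) .one)
          (fun i => .var i.succ.succ)))
        A)
      (hΞ : Ctx.IsBoundedSum H Γ Ξ) :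
      HasType S Φ Ξ (.add H (.sum H J)) (.fix x t)
        -- `[a < K] B{0/a}{(forest of `a` trees from `0` on) / b}`
        (.bang K ((B.inst .zero).subst (Fin.cases
          (.forest .zero (.var 0) (I.rename (liftRen fun i => i.succ)))
          (fun i => .var i.succ))))

/-! ### The CEK machine -/

/-- Environments: `cons x v η ξ` is the environment `(x ↦ ⟨v; η⟩) · ξ`, which assigns the value
closure `⟨v; η⟩` to `x`. -/
inductive Env
  | nil
  | cons (x : Var) (v : Val) (η ξ : Env)

/-- Closures `⟨t; ξ⟩`. -/
structure Closure where
  tm : Tm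
  env : Env

/-- Value closures `⟨v; ξ⟩`. -/
structure VClosure where
  val : Val
  env : Env

def VClosure.toClosure (V : VClosure) : Closure := ⟨V.val.toTm, V.env⟩

/-- `ξ(x)`: the first (most recent) value closure that `ξ` assigns to `x`, if any. -/
def Env.lookup : Env → Var → Option VClosure
  | .nil, _ => none
  | .cons y v η ξ, x => if x = y then some ⟨v, η⟩ else ξ.lookup x

inductive Stack
  | nil
  | func (V : VClosure) (π : Stack)
  | arg (c : Closure) (π : Stack)
  | fork (t u : Tm) (ξ : Env) (π : Stack)
  | succ (π : Stack)
  | pred (π : Stack)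

/-- States `c ⋆ π` of the machine. -/
structure State where
  clo : Closure
  stack : Stack

/-- One transition of the CEK machine. -/
inductive Step : State → State → Prop
  | arg (V : VClosure) (c : Closure) (π : Stack) :
      Step ⟨V.toClosure, .arg c π⟩ ⟨c, .func V π⟩
  | lam (V : VClosure) (x : Var) (t : Tm) (ξ : Env) (π : Stack) :
      Step ⟨V.toClosure, .func ⟨.lam x t, ξ⟩ π⟩ ⟨⟨t, .cons x V.val V.env ξ⟩, π⟩
  | fix (V : VClosure) (x : Var) (t : Tm) (ξ : Env) (π : Stack) :
      Step ⟨V.toClosure, .func ⟨.fix x t, ξ⟩ π⟩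
        ⟨⟨t, .cons x (.fix x t) ξ ξ⟩, .arg V.toClosure π⟩
  | forkZero (t u : Tm) (η ξ : Env) (π : Stack) :
      Step ⟨⟨.num 0, η⟩, .fork t u ξ π⟩ ⟨⟨t, ξ⟩, π⟩
  | forkSucc (n : ℕ) (t u : Tm) (η ξ : Env) (π : Stack) :
      Step ⟨⟨.num (n + 1), η⟩, .fork t u ξ π⟩ ⟨⟨u, ξ⟩, π⟩
  | succNum (n : ℕ) (ξ : Env) (π : Stack) :
      Step ⟨⟨.num n, ξ⟩, .succ π⟩ ⟨⟨.num (n + 1), .nil⟩, π⟩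
  | predNum (n : ℕ) (ξ : Env) (π : Stack) :
      Step ⟨⟨.num n, ξ⟩, .pred π⟩ ⟨⟨.num (n - 1), .nil⟩, π⟩
  | var (x : Var) (ξ : Env) (π : Stack) (V : VClosure) (hV : ξ.lookup x = some V) :
      Step ⟨⟨.var x, ξ⟩, π⟩ ⟨V.toClosure, π⟩
  | app (t u : Tm) (ξ : Env) (π : Stack) :
      Step ⟨⟨.app t u, ξ⟩, π⟩ ⟨⟨t, ξ⟩, .arg ⟨u, ξ⟩ π⟩
  | succ (t : Tm) (ξ : Env) (π : Stack) :
      Step ⟨⟨.succ t, ξ⟩, π⟩ ⟨⟨t, ξ⟩, .succ π⟩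
  | pred (t : Tm) (ξ : Env) (π : Stack) :
      Step ⟨⟨.pred t, ξ⟩, π⟩ ⟨⟨t, ξ⟩, .pred π⟩
  | ifz (t u s : Tm) (ξ : Env) (π : Stack) :
      Step ⟨⟨.ifz t u s, ξ⟩, π⟩ ⟨⟨t, ξ⟩, .fork u s ξ π⟩

/-- Exactly `n` transitions. -/
inductive Steps : ℕ → State → State → Prop
  | refl (P : State) : Steps 0 P P
  | head {n : ℕ} {P Q R : State} (h : Step P Q) (hs : Steps n Q R) : Steps (n + 1) P R

/-- `t` evaluates to the numeral `m` in exactly `n` steps: started from `⟨t; ∅⟩` with the empty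
stack, the machine reaches a closure of the numeral `m` with the empty stack. The environment left
in that closure is irrelevant, as a numeral is closed. -/
def EvalsIn (t : Tm) (n m : ℕ) : Prop :=
  ∃ ξ : Env, Steps n ⟨⟨t, .nil⟩, .nil⟩ ⟨⟨.num m, ξ⟩, .nil⟩

end DLPCF

/-!
The proof is a quantitative realizability argument. Fix a bound `N` on the sizes of the terms in
play. A modal or linear type `τ` is read, under an assignment `ρ` of its index variables, as a
relation `Ty.Realizes S N τ ρ w V` between value closures `V` and *budgets* `w`: an arrow is realized
with budget `w` if every application to an argument with budget `w'` terminates, and its running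
time, counted in units of `N` transitions, together with the budget of the result does not exceed
`w + w'`; a type `[a < I] A` is realized by splitting the budget among the `I` copies; `Nat[I, J]` is realized
by the numerals in the interval, at no cost. Since entailments between index terms are semantic,
only the evaluation of substituted index terms matters, and subtyping becomes inclusion of
realizers (`SubTy.realizes`). The sums `⊎` and `∑` of types are splittings of budgets
(`Ty.IsSum.split`, `Ty.IsBoundedSum.split`).

Soundness (`HasType.sound`) says that a term of weight `k` in an environment with budget `W`
evaluates to a realizer of its type, with running time plus `N` times the remaining budget at most
`N * (k + W) + |t|`. The steps which decompose a term are paid for by its size; entering the body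
of a `λ` or `fix` costs one unit of weight, that is, `N` steps, which pays for the size of the body.
For `fix`, the budget of a node in the forest of recursive calls is the total budget of its subtree;
the induction over the finite forest is `realizes_of_forest`. For the closed program `t` one takes
`N = |t|` and `W = 0`.
-/

namespace DLPCF

universe u

variable {Θ : Signature.{u}}

/-! ### Evaluation of index terms -/

theorem mem_boundedSum {f : ℕ → Part ℕ} {m n : ℕ} :
    n ∈ boundedSum f m ↔
      ∃ g : ℕ → ℕ, (∀ a < m, g a ∈ f a) ∧ ∑ a ∈ Finset.range m, g a = n := by
  induction m generalizing n with
  | zero => simp [boundedSum, eq_comm]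
  | succ m ih =>
    simp only [boundedSum, Part.mem_bind_iff, Part.mem_map_iff, ih]
    constructor
    · rintro ⟨x, ⟨g, hg, rfl⟩, y, hy, rfl⟩
      refine ⟨Function.update g m y, fun a ha => ?_, ?_⟩
      · rcases Nat.lt_succ_iff_lt_or_eq.mp ha with h | rfl
        · rw [Function.update_of_ne h.ne]
          exact hg a h
        · simpa using hy
      · rw [Finset.sum_range_succ, Function.update_self]
        congr 1
        refine Finset.sum_congr rfl fun a ha => ?_
        rw [Function.update_of_ne (Finset.mem_range.mp ha).ne]
    · rintro ⟨g, hg, rfl⟩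
      exact ⟨_, ⟨g, fun a ha => hg a (by omega), rfl⟩, g m, hg m (by omega),
        (Finset.sum_range_succ _ _).symm⟩

theorem cons_liftRen {φ ψ : ℕ} (r : Fin φ → Fin ψ) (ρ : Fin ψ → ℕ) (a : ℕ) (i : Fin (φ + 1)) :
    (Fin.cons a ρ : Fin (ψ + 1) → ℕ) (liftRen r i) =
      (Fin.cons a fun i => ρ (r i) : Fin (φ + 1) → ℕ) i := by
  refine Fin.cases ?_ (fun i => ?_) i <;> simp [liftRen]

namespace Idx

theorem eval_app_congr (S : Interp Θ) {f : Θ.Sym} {φ ψ : ℕ} {p : Fin (Θ.arity f) → Idx Θ φ}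
    {q : Fin (Θ.arity f) → Idx Θ ψ} {ρ : Fin φ → ℕ} {ρ' : Fin ψ → ℕ}
    (h : ∀ i, (p i).eval S ρ = (q i).eval S ρ') : (app f p).eval S ρ = (app f q).eval S ρ' :=
  congrArg (fun e : Fin (Θ.arity f) → Part ℕ =>
    (⟨∀ i, (e i).Dom, fun h i => (e i).get (h i)⟩ : Part (Fin (Θ.arity f) → ℕ)).bind (S f))
    (funext h)

theorem eval_rename (S : Interp Θ) {φ : ℕ} (I : Idx Θ φ) {ψ : ℕ} (r : Fin φ → Fin ψ)
    (ρ : Fin ψ → ℕ) : (I.rename r).eval S ρ = I.eval S (fun i => ρ (r i)) := by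
  induction I generalizing ψ with
  | var | zero | one => rfl
  | add I J ihI ihJ | monus I J ihI ihJ => simp only [rename, eval, ihI, ihJ]
  | app f args ih => exact eval_app_congr S fun i => ih i r ρ
  | sum I J ihI ihJ => simp only [rename, eval, ihI, ihJ, cons_liftRen]
  | forest I J K ihI ihJ ihK => simp only [rename, eval, ihI, ihJ, ihK, cons_liftRen]

@[simp]
theorem eval_wk (S : Interp Θ) {φ : ℕ} (I : Idx Θ φ) (ρ : Fin φ → ℕ) (a : ℕ) :
    I.wk.eval S (Fin.cons a ρ) = I.eval S ρ := by
  simp [wk, eval_rename]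

/-- The substitution `s` evaluates to the assignment `ρ'` under `ρ`. In particular all the
substituted index terms are defined. -/
def EvalsTo (S : Interp Θ) {φ ψ : ℕ} (s : Fin φ → Idx Θ ψ) (ρ : Fin ψ → ℕ) (ρ' : Fin φ → ℕ) :
    Prop :=
  ∀ i, (s i).eval S ρ = Part.some (ρ' i)

theorem EvalsTo.up {S : Interp Θ} {φ ψ : ℕ} {s : Fin φ → Idx Θ ψ} {ρ : Fin ψ → ℕ}
    {ρ' : Fin φ → ℕ} (h : EvalsTo S s ρ ρ') (a : ℕ) :
    EvalsTo S (Idx.up s) (Fin.cons a ρ) (Fin.cons a ρ') := by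
  intro i
  refine Fin.cases ?_ (fun i => ?_) i
  · simp [Idx.up, eval]
  · simpa [Idx.up] using h i

theorem EvalsTo.eval_subst {S : Interp Θ} {φ : ℕ} (I : Idx Θ φ) {ψ : ℕ} {s : Fin φ → Idx Θ ψ}
    {ρ : Fin ψ → ℕ} {ρ' : Fin φ → ℕ} (h : EvalsTo S s ρ ρ') :
    (I.subst s).eval S ρ = I.eval S ρ' := by
  induction I generalizing ψ with
  | var a => exact h a
  | zero | one => rfl
  | add I J ihI ihJ | monus I J ihI ihJ => simp only [subst, eval, ihI h, ihJ h]
  | app f args ih => exact eval_app_congr S fun i => ih i h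
  | sum I J ihI ihJ => simp only [subst, eval, ihI h, ihJ (h.up _)]
  | forest I J K ihI ihJ ihK => simp only [subst, eval, ihI h, ihJ h, ihK (h.up _)]

theorem mem_eval_add {S : Interp Θ} {φ : ℕ} {I J : Idx Θ φ} {ρ : Fin φ → ℕ} {n : ℕ} :
    n ∈ (I.add J).eval S ρ ↔ ∃ x ∈ I.eval S ρ, ∃ y ∈ J.eval S ρ, x + y = n := by
  simp [eval]

theorem mem_eval_monus {S : Interp Θ} {φ : ℕ} {I J : Idx Θ φ} {ρ : Fin φ → ℕ} {n : ℕ} :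
    n ∈ (I.monus J).eval S ρ ↔ ∃ x ∈ I.eval S ρ, ∃ y ∈ J.eval S ρ, x - y = n := by
  simp [eval]

theorem mem_eval_sum {S : Interp Θ} {φ : ℕ} {I : Idx Θ φ} {J : Idx Θ (φ + 1)} {ρ : Fin φ → ℕ}
    {n : ℕ} :
    n ∈ (I.sum J).eval S ρ ↔ ∃ i ∈ I.eval S ρ, ∃ g : ℕ → ℕ,
      (∀ a < i, g a ∈ J.eval S (Fin.cons a ρ)) ∧ ∑ a ∈ Finset.range i, g a = n := by
  simp only [eval, Part.mem_bind_iff, mem_boundedSum]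

theorem mem_eval_forest {S : Interp Θ} {φ : ℕ} {I J : Idx Θ φ} {K : Idx Θ (φ + 1)}
    {ρ : Fin φ → ℕ} {n : ℕ} :
    n ∈ (I.forest J K).eval S ρ ↔ ∃ i ∈ I.eval S ρ, ∃ j ∈ J.eval S ρ,
      Forest (fun a => K.eval S (Fin.cons a ρ)) i j n := by
  simp only [eval, Part.mem_bind_iff, mem_forestCard]

theorem eval_num (S : Interp Θ) {φ : ℕ} (n : ℕ) (ρ : Fin φ → ℕ) :
    (num n : Idx Θ φ).eval S ρ = Part.some n := by
  induction n using num.induct with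
  | case1 | case2 => rfl
  | case3 n ih => simp [num, eval, ih]

end Idx

/-! ### Constraints -/

/-- The assignment `ρ` makes all constraints in `Φ` true. -/
def ICtx.Holds (S : Interp Θ) {φ : ℕ} (Φ : ICtx Θ φ) (ρ : Fin φ → ℕ) : Prop :=
  ∀ c ∈ Φ, c.Holds S ρ

theorem ICtx.Holds.cons {S : Interp Θ} {φ : ℕ} {Φ : ICtx Θ φ} {ρ : Fin φ → ℕ}
    {c : Constraint Θ φ} (hc : c.Holds S ρ) (h : Holds S Φ ρ) : Holds S (c :: Φ) ρ :=
  List.forall_mem_cons.mpr ⟨hc, h⟩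

theorem ICtx.Holds.wk {S : Interp Θ} {φ : ℕ} {Φ : ICtx Θ φ} {ρ : Fin φ → ℕ}
    (h : Holds S Φ ρ) (a : ℕ) : Holds S Φ.wk (Fin.cons a ρ) := by
  intro c hc
  obtain ⟨d, hd, rfl⟩ := List.mem_map.mp hc
  simpa [Constraint.Holds, Constraint.wk] using h d hd

theorem Constraint.holds_lt {S : Interp Θ} {φ : ℕ} {I J : Idx Θ φ} {ρ : Fin φ → ℕ} {i j : ℕ}
    (hi : i ∈ I.eval S ρ) (hj : j ∈ J.eval S ρ) (h : i < j) : (lt I J).Holds S ρ :=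
  ⟨i + 1, Idx.mem_eval_add.mpr ⟨i, hi, 1, Part.mem_some 1, rfl⟩, j, hj, h⟩

theorem ICtx.Holds.bind {S : Interp Θ} {φ : ℕ} {Φ : ICtx Θ φ} {ρ : Fin φ → ℕ}
    (h : Holds S Φ ρ) {I : Idx Θ φ} {i a : ℕ} (hi : i ∈ I.eval S ρ) (ha : a < i) :
    Holds S (.lt (.var 0) I.wk :: Φ.wk) (Fin.cons a ρ) :=
  .cons (Constraint.holds_lt (Part.mem_some a) (by simpa using hi) ha) (h.wk a)

/-! ### Runs of the machine -/

theorem Steps.single {P Q : State} (h : Step P Q) : Steps 1 P Q := .head h (.refl Q)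

theorem Steps.trans {m n : ℕ} {P Q R : State} (h : Steps m P Q) (h' : Steps n Q R) :
    Steps (m + n) P R := by
  induction h with
  | refl => simpa using h'
  | @head k _ _ _ hs _ ih =>
    rw [Nat.add_right_comm]
    exact .head hs (ih h')

/-- The closure `c` evaluates to `V` in exactly `n` steps, on every stack. -/
def Evaluates (n : ℕ) (c : Closure) (V : VClosure) : Prop :=
  ∀ π, Steps n ⟨c, π⟩ ⟨V.toClosure, π⟩

/-- The function `V`, applied to the argument `U`, returns `W` in exactly `n` steps, on every
stack. -/
def Applies (n : ℕ) (V U W : VClosure) : Prop :=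
  ∀ π, Steps n ⟨U.toClosure, .func V π⟩ ⟨W.toClosure, π⟩

theorem Evaluates.app {t u : Tm} {ξ : Env} {V U W : VClosure} {l m n : ℕ}
    (ht : Evaluates l ⟨t, ξ⟩ V) (hu : Evaluates m ⟨u, ξ⟩ U) (h : Applies n V U W) :
    Evaluates (1 + (l + (1 + (m + n)))) ⟨.app t u, ξ⟩ W := fun π =>
  (Steps.single (.app t u ξ π)).trans <| (ht _).trans <|
    (Steps.single (.arg V _ π)).trans <| (hu _).trans (h π)

theorem Applies.lam {x : Var} {t : Tm} {ξ : Env} {U W : VClosure} {n : ℕ}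
    (h : Evaluates n ⟨t, .cons x U.val U.env ξ⟩ W) : Applies (1 + n) ⟨.lam x t, ξ⟩ U W := fun π =>
  (Steps.single (.lam U x t ξ π)).trans (h π)

theorem Applies.fix {x : Var} {t : Tm} {ξ : Env} {V U W : VClosure} {m n : ℕ}
    (h : Evaluates m ⟨t, .cons x (.fix x t) ξ ξ⟩ V) (h' : Applies n V U W) :
    Applies (1 + (m + (1 + n))) ⟨.fix x t, ξ⟩ U W := fun π =>
  (Steps.single (.fix U x t ξ π)).trans <| (h _).trans <| (Steps.single (.arg V _ π)).trans (h' π)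

/-! ### Realizability -/

/-- `τ.Realizes S N ρ w V`: under the assignment `ρ`, the value closure `V` realizes the type `τ`
with budget `w`. One unit of budget pays for `N` transitions of the machine. The index terms at the
top of a modal type are required to be defined. -/
def Ty.Realizes (S : Interp Θ) (N : ℕ) :
    {k : Kind} → {φ : ℕ} → Ty Θ k φ → (Fin φ → ℕ) → ℕ → VClosure → Prop
  | _, _, .arrow σ τ, ρ, w, V => ∀ w' U, σ.Realizes S N ρ w' U →
      ∃ n w'' W, Applies n V U W ∧ n + N * w'' ≤ N * (w + w') ∧ τ.Realizes S N ρ w'' W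
  | _, _, .bang I A, ρ, w, V => ∃ i ∈ I.eval S ρ, ∃ f : ℕ → ℕ,
      ∑ a ∈ Finset.range i, f a ≤ w ∧ ∀ a < i, A.Realizes S N (Fin.cons a ρ) (f a) V
  | _, _, .nat I J, ρ, _, V =>
      ∃ i ∈ I.eval S ρ, ∃ j ∈ J.eval S ρ, ∃ m, V.val = .num m ∧ i ≤ m ∧ m ≤ j

variable {S : Interp Θ} {N : ℕ}

theorem Ty.Realizes.mono {k : Kind} {φ : ℕ} {τ : Ty Θ k φ} {ρ : Fin φ → ℕ} {w w' : ℕ}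
    {V : VClosure} (h : τ.Realizes S N ρ w V) (hw : w ≤ w') : τ.Realizes S N ρ w' V := by
  cases τ with
  | arrow σ τ =>
    intro v U hU
    obtain ⟨n, w'', W, hW, hn, hτ⟩ := h v U hU
    exact ⟨n, w'', W, hW, hn.trans (by gcongr), hτ⟩
  | bang I A =>
    obtain ⟨i, hi, f, hf, hA⟩ := h
    exact ⟨i, hi, f, hf.trans hw, hA⟩
  | nat I J => exact h

theorem Ty.realizes_subst {k : Kind} {φ : ℕ} (τ : Ty Θ k φ) {ψ : ℕ} {s : Fin φ → Idx Θ ψ}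
    {ρ : Fin ψ → ℕ} {ρ' : Fin φ → ℕ} (h : Idx.EvalsTo S s ρ ρ') (w : ℕ) (V : VClosure) :
    (τ.subst s).Realizes S N ρ w V ↔ τ.Realizes S N ρ' w V := by
  induction τ generalizing ψ w V with
  | arrow σ τ ihσ ihτ => simp only [subst, Realizes, ihσ h, ihτ h]
  | bang I A ih => simp only [subst, Realizes, h.eval_subst, ih (h.up _)]
  | nat I J => simp only [subst, Realizes, h.eval_subst]

theorem Ty.realizes_inst {k : Kind} {φ : ℕ} (τ : Ty Θ k (φ + 1)) {I : Idx Θ φ} {ρ : Fin φ → ℕ}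
    {i : ℕ} (hi : i ∈ I.eval S ρ) (w : ℕ) (V : VClosure) :
    (τ.inst I).Realizes S N ρ w V ↔ τ.Realizes S N (Fin.cons i ρ) w V := by
  refine τ.realizes_subst (fun j => ?_) w V
  refine Fin.cases ?_ (fun j => ?_) j
  · simpa using Part.eq_some_iff.mpr hi
  · simp [Idx.eval]

theorem SubTy.realizes {k : Kind} {φ : ℕ} {Φ : ICtx Θ φ} {A B : Ty Θ k φ} (h : SubTy S Φ A B)
    {ρ : Fin φ → ℕ} (hρ : Φ.Holds S ρ) {w : ℕ} {V : VClosure} (hA : A.Realizes S N ρ w V) :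
    B.Realizes S N ρ w V := by
  induction h generalizing w V with
  | nat hl hr =>
    obtain ⟨i, hi, j, hj, m, hm, him, hmj⟩ := hA
    obtain ⟨k, hk, i', hi', hki⟩ := hl ρ hρ
    obtain ⟨j', hj', l, hl, hjl⟩ := hr ρ hρ
    obtain rfl := Part.mem_unique hi hi'
    obtain rfl := Part.mem_unique hj hj'
    exact ⟨k, hk, l, hl, m, hm, hki.trans him, hmj.trans hjl⟩
  | arrow _ _ ihσ ihτ =>
    intro w' U hU
    obtain ⟨n, w'', W, hW, hn, hτ⟩ := hA w' U (ihσ hρ hU)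
    exact ⟨n, w'', W, hW, hn, ihτ hρ hτ⟩
  | bang _ hI ih =>
    obtain ⟨i, hi, f, hf, hA⟩ := hA
    obtain ⟨j, hj, i', hi', hji⟩ := hI ρ hρ
    obtain rfl := Part.mem_unique hi hi'
    refine ⟨j, hj, f, le_trans (Finset.sum_le_sum_of_subset ?_) hf, fun a ha => ?_⟩
    · exact Finset.range_subset_range.mpr hji
    · exact ih (hρ.bind hj ha) (hA a (ha.trans_le hji))

/-! ### Splitting of budgets -/

theorem Ty.IsSum.split {φ : ℕ} {σ τ υ : ModTy Θ φ} (h : Ty.IsSum σ τ υ) {ρ : Fin φ → ℕ} {w : ℕ}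
    {V : VClosure} (hV : υ.Realizes S N ρ w V) :
    ∃ w₁ w₂, w₁ + w₂ ≤ w ∧ σ.Realizes S N ρ w₁ V ∧ τ.Realizes S N ρ w₂ V := by
  cases h with
  | nat => exact ⟨w, 0, le_rfl, hV, hV⟩
  | bang I J A =>
    obtain ⟨n, hn, f, hf, hA⟩ := hV
    obtain ⟨i, hi, j, hj, rfl⟩ := Idx.mem_eval_add.mp hn
    rw [Finset.sum_range_add] at hf
    refine ⟨_, _, hf, ⟨i, hi, f, le_rfl, fun a ha => hA a (by omega)⟩,
      j, hj, fun b => f (i + b), le_rfl, fun b hb => ?_⟩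
    refine (A.realizes_subst (ρ' := Fin.cons (i + b) ρ) (fun c => ?_) _ V).mpr
      (hA (i + b) (by omega))
    refine Fin.cases ?_ (fun c => ?_) c
    · simp [Idx.eval, Part.eq_some_iff.mpr hi]
    · simp [Idx.eval]

/-- An initial segment cut into consecutive blocks of lengths `g 0, g 1, …`. -/
theorem sum_range_sum (f g : ℕ → ℕ) (i : ℕ) :
    ∑ c ∈ Finset.range (∑ a ∈ Finset.range i, g a), f c =
      ∑ a ∈ Finset.range i, ∑ b ∈ Finset.range (g a), f (b + ∑ d ∈ Finset.range a, g d) := by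
  induction i with
  | zero => simp
  | succ i ih =>
    rw [Finset.sum_range_succ, Finset.sum_range_add, ih, Finset.sum_range_succ]
    simp only [add_comm]

theorem Ty.IsBoundedSum.split {φ : ℕ} {I : Idx Θ φ} {σ : ModTy Θ (φ + 1)} {υ : ModTy Θ φ}
    (h : Ty.IsBoundedSum I σ υ) {ρ : Fin φ → ℕ} {w i : ℕ} {V : VClosure} (hi : i ∈ I.eval S ρ)
    (hV : υ.Realizes S N ρ w V) :
    ∃ f : ℕ → ℕ, ∑ a ∈ Finset.range i, f a ≤ w ∧
      ∀ a < i, σ.Realizes S N (Fin.cons a ρ) (f a) V := by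
  cases h with
  | nat J K => exact ⟨fun _ => 0, by simp, fun a _ => by simpa [Realizes] using hV⟩
  | bang J A =>
    obtain ⟨n, hn, f, hf, hA⟩ := hV
    obtain ⟨i', hi', g, hg, rfl⟩ := Idx.mem_eval_sum.mp hn
    obtain rfl := Part.mem_unique hi hi'
    rw [sum_range_sum] at hf
    refine ⟨_, hf, fun a ha => ⟨g a, hg a ha, _, le_rfl, fun b hb => ?_⟩⟩
    have hlt : b + ∑ d ∈ Finset.range a, g d < ∑ d ∈ Finset.range i, g d := by
      calc b + ∑ d ∈ Finset.range a, g d < ∑ d ∈ Finset.range (a + 1), g d := by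
            rw [Finset.sum_range_succ]; omega
        _ ≤ _ := Finset.sum_le_sum_of_subset (Finset.range_subset_range.mpr ha)
    refine (A.realizes_subst (ρ' := Fin.cons (b + ∑ d ∈ Finset.range a, g d) ρ) (fun c => ?_) _
      V).mpr (hA _ hlt)
    refine Fin.cases ?_ (fun c => ?_) c
    · refine Part.eq_some_iff.mpr (Idx.mem_eval_add.mpr ⟨b, Part.mem_some b, _, ?_, rfl⟩)
      refine Idx.mem_eval_sum.mpr ⟨a, Part.mem_some a, g, fun d hd => ?_, rfl⟩
      simpa [Idx.eval_rename, cons_liftRen] using hg d (hd.trans ha)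
    · rfl

/-- The environment `ξ` realizes the context `Γ` under `ρ` with total budget `W`. The context may
declare infinitely many variables, but only those in a finite set `s` may use any budget. -/
def Ctx.Realizes (S : Interp Θ) (N : ℕ) {φ : ℕ} (Γ : Ctx Θ φ) (ρ : Fin φ → ℕ) (W : ℕ) (ξ : Env) :
    Prop :=
  ∃ (s : Finset Var) (w : Var → ℕ), (∀ x ∉ s, w x = 0) ∧ ∑ x ∈ s, w x ≤ W ∧
    ∀ x σ, Γ x = some σ → ∃ V, ξ.lookup x = some V ∧ σ.Realizes S N ρ (w x) V

theorem Ctx.realizes_empty {φ : ℕ} (ρ : Fin φ → ℕ) (ξ : Env) :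
    (Ctx.empty : Ctx Θ φ).Realizes S N ρ 0 ξ :=
  ⟨∅, fun _ => 0, by simp, by simp, fun _ _ h => nomatch h⟩

theorem Ctx.Realizes.extend {φ : ℕ} {Γ : Ctx Θ φ} {ρ : Fin φ → ℕ} {W v : ℕ} {ξ : Env}
    (h : Γ.Realizes S N ρ W ξ) {σ : ModTy Θ φ} {V : VClosure} (hV : σ.Realizes S N ρ v V)
    (x : Var) : (Γ.extend x σ).Realizes S N ρ (W + v) (.cons x V.val V.env ξ) := by
  obtain ⟨s, w, hs, hW, hΓ⟩ := h
  refine ⟨insert x s, Function.update w x v, fun y hy => ?_, ?_, fun y τ hy => ?_⟩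
  · rw [Finset.mem_insert, not_or] at hy
    rw [Function.update_of_ne hy.1, hs y hy.2]
  · rw [← Finset.insert_erase (Finset.mem_insert_self x s), Finset.sum_insert (by simp),
      Function.update_self, add_comm]
    gcongr
    refine le_trans ?_ hW
    rw [Finset.erase_insert_eq_erase]
    calc _ = ∑ y ∈ s.erase x, w y := Finset.sum_congr rfl fun y hy => by
            rw [Function.update_of_ne (Finset.ne_of_mem_erase hy)]
      _ ≤ _ := Finset.sum_le_sum_of_subset (Finset.erase_subset _ _)
  · by_cases hyx : y = x
    · subst hyx
      obtain rfl : σ = τ := by simpa [Ctx.extend] using hy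
      exact ⟨V, by simp [Env.lookup], by simpa using hV⟩
    · rw [Ctx.extend, Function.update_of_ne hyx] at hy
      simpa [Env.lookup, hyx, Function.update_of_ne hyx] using hΓ y τ hy

theorem Ctx.Sub.realizes {φ : ℕ} {Φ : ICtx Θ φ} {Γ Δ : Ctx Θ φ} (h : Ctx.Sub S Φ Δ Γ)
    {ρ : Fin φ → ℕ} (hρ : Φ.Holds S ρ) {W : ℕ} {ξ : Env} (hΔ : Δ.Realizes S N ρ W ξ) :
    Γ.Realizes S N ρ W ξ := by
  obtain ⟨s, w, hs, hW, hΔ⟩ := hΔ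
  refine ⟨s, w, hs, hW, fun x σ hx => ?_⟩
  obtain ⟨δ, hδ, hsub⟩ := h x σ hx
  obtain ⟨V, hV, hR⟩ := hΔ x δ hδ
  exact ⟨V, hV, hsub.realizes hρ hR⟩

theorem Ctx.IsSum.split {φ : ℕ} {Γ Δ Ξ : Ctx Θ φ} (h : Ctx.IsSum Γ Δ Ξ) {ρ : Fin φ → ℕ} {W : ℕ}
    {ξ : Env} (hΞ : Ξ.Realizes S N ρ W ξ) :
    ∃ W₁ W₂, W₁ + W₂ ≤ W ∧ Γ.Realizes S N ρ W₁ ξ ∧ Δ.Realizes S N ρ W₂ ξ := by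
  obtain ⟨s, w, hs, hW, hΞ⟩ := hΞ
  have key : ∀ x, ∃ w₁ w₂, w₁ + w₂ ≤ w x ∧
      (∀ σ, Γ x = some σ → ∃ V, ξ.lookup x = some V ∧ σ.Realizes S N ρ w₁ V) ∧
      (∀ τ, Δ x = some τ → ∃ V, ξ.lookup x = some V ∧ τ.Realizes S N ρ w₂ V) := by
    intro x
    have hx := h x
    rcases hΓ : Γ x with _ | σ <;> rcases hΔ : Δ x with _ | τ <;> rw [hΓ, hΔ] at hx
    · exact ⟨0, 0, by simp, by simp, by simp⟩
    · exact ⟨0, w x, by simp, by simp, by rintro _ ⟨⟩; exact hΞ x τ hx⟩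
    · exact ⟨w x, 0, by simp, by rintro _ ⟨⟩; exact hΞ x σ hx, by simp⟩
    · obtain ⟨υ, hυ, hx⟩ := hx
      obtain ⟨V, hV, hR⟩ := hΞ x υ hx
      obtain ⟨w₁, w₂, hw, h₁, h₂⟩ := hυ.split hR
      exact ⟨w₁, w₂, hw, by rintro _ ⟨⟩; exact ⟨V, hV, h₁⟩, by rintro _ ⟨⟩; exact ⟨V, hV, h₂⟩⟩
  choose w₁ w₂ hw h₁ h₂ using key
  refine ⟨_, _, ?_, ⟨s, w₁, fun x hx => ?_, le_rfl, h₁⟩, s, w₂, fun x hx => ?_, le_rfl, h₂⟩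
  · rw [← Finset.sum_add_distrib]
    exact (Finset.sum_le_sum fun x _ => hw x).trans hW
  all_goals
    have := hw x
    have := hs x hx
    omega

theorem Ctx.IsBoundedSum.split {φ : ℕ} {I : Idx Θ φ} {Γ : Ctx Θ (φ + 1)} {Ξ : Ctx Θ φ}
    (h : Ctx.IsBoundedSum I Γ Ξ) {ρ : Fin φ → ℕ} {W i : ℕ} {ξ : Env} (hi : i ∈ I.eval S ρ)
    (hΞ : Ξ.Realizes S N ρ W ξ) :
    ∃ f : ℕ → ℕ, ∑ a ∈ Finset.range i, f a ≤ W ∧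
      ∀ a < i, Γ.Realizes S N (Fin.cons a ρ) (f a) ξ := by
  obtain ⟨s, w, hs, hW, hΞ⟩ := hΞ
  have key : ∀ x, ∃ f : ℕ → ℕ, ∑ a ∈ Finset.range i, f a ≤ w x ∧ ∀ a < i, ∀ σ, Γ x = some σ →
      ∃ V, ξ.lookup x = some V ∧ σ.Realizes S N (Fin.cons a ρ) (f a) V := by
    intro x
    have hx := h x
    rcases hΓ : Γ x with _ | σ <;> rw [hΓ] at hx
    · exact ⟨fun _ => 0, by simp, by simp⟩
    · obtain ⟨υ, hυ, hx⟩ := hx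
      obtain ⟨V, hV, hR⟩ := hΞ x υ hx
      obtain ⟨f, hf, hσ⟩ := hυ.split hi hR
      exact ⟨f, hf, by rintro a ha _ ⟨⟩; exact ⟨V, hV, hσ a ha⟩⟩
  choose f hf hΓ using key
  refine ⟨fun a => ∑ x ∈ s, f x a, ?_, fun a ha =>
    ⟨s, fun x => f x a, fun x hx => ?_, le_rfl, fun x => hΓ x a ha⟩⟩
  · rw [Finset.sum_comm]
    exact (Finset.sum_le_sum fun x _ => hf x).trans hW
  · have h₁ := Finset.single_le_sum (fun a _ => Nat.zero_le (f x a)) (Finset.mem_range.mpr ha)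
    have h₂ := hf x
    have h₃ := hs x hx
    change f x a = 0
    omega

/-! ### Recursion along forests -/

/-- If every node of a forest has property `P` with the budget `c` of its own plus the budget of its
children, then the roots have property `P` with budgets that add up to the budget of all nodes. -/
theorem realizes_of_forest {k : ℕ → Part ℕ} {P : ℕ → ℕ → Prop} {c : ℕ → ℕ} {h : ℕ}
    (step : ∀ b < h, ∀ m ∈ k b, ∀ f : ℕ → ℕ,
      (∀ a < m, ∃ x, Forest k (b + 1) a x ∧ P (b + 1 + x) (f a)) →
      P b (c b + ∑ a ∈ Finset.range m, f a))
    {i j n : ℕ} (hF : Forest k i j n) (hn : i + n ≤ h) :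
    ∃ f : ℕ → ℕ, ∑ a ∈ Finset.range j, f a = ∑ b ∈ Finset.range n, c (i + b) ∧
      ∀ a < j, ∃ x, Forest k i a x ∧ P (i + x) (f a) := by
  induction hF with
  | zero i => exact ⟨fun _ => 0, by simp, by simp⟩
  | @succ i j x m y trees children subtrees ih₁ ih₂ =>
    obtain ⟨f, hf, hP⟩ := ih₁ (by omega)
    obtain ⟨g, hg, hQ⟩ := ih₂ (by omega)
    have root : P (i + x) (c (i + x) + ∑ a ∈ Finset.range m, g a) := by
      refine step _ (by omega) m children g fun a ha => ?_
      obtain ⟨z, hz, hR⟩ := hQ a ha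
      rw [Nat.add_right_comm i 1 x] at hz hR
      exact ⟨z, hz, hR⟩
    refine ⟨Function.update f j (c (i + x) + ∑ a ∈ Finset.range m, g a), ?_, fun a ha => ?_⟩
    · rw [Finset.sum_range_succ, Function.update_self, hg, Finset.sum_range_add,
        Finset.sum_range_succ, ← hf]
      have : ∀ b, i + 1 + x + b = i + (x + 1 + b) := fun b => by omega
      simp only [this]
      rw [add_assoc]
      congr 1
      refine Finset.sum_congr rfl fun a ha => ?_
      rw [Function.update_of_ne (Finset.mem_range.mp ha).ne]
    · rcases Nat.lt_succ_iff_lt_or_eq.mp ha with ha | rfl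
      · rw [Function.update_of_ne ha.ne]
        exact hP a ha
      · rw [Function.update_self]
        exact ⟨x, trees, root⟩

/-! ### Soundness -/

/-- The term `t` in the environment `ξ` evaluates to a realizer of `τ`. A budget `w` before the
evaluation covers its running time, up to `|t|` transitions, and the budget of the value. -/
def RealizesTm (S : Interp Θ) (N : ℕ) {φ : ℕ} (τ : ModTy Θ φ) (ρ : Fin φ → ℕ) (w : ℕ) (t : Tm)
    (ξ : Env) : Prop :=
  ∃ n w' V, Evaluates n ⟨t, ξ⟩ V ∧ n + N * w' ≤ N * w + t.size ∧ τ.Realizes S N ρ w' V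

/-- A value realizes a type as a term if it does so as a value closure. -/
theorem Ty.Realizes.toTm {φ : ℕ} {τ : ModTy Θ φ} {ρ : Fin φ → ℕ} {w : ℕ} {v : Val} {ξ : Env}
    (h : τ.Realizes S N ρ w ⟨v, ξ⟩) : RealizesTm S N τ ρ w v.toTm ξ :=
  ⟨0, w, ⟨v, ξ⟩, fun _ => .refl _, by omega, h⟩

/-- Every well-typed term of defined weight realizes its type, in every environment which realizes
its context. -/
theorem HasType.sound {φ : ℕ} {Φ : ICtx Θ φ} {Γ : Ctx Θ φ} {K : Idx Θ φ} {t : Tm} {τ : ModTy Θ φ}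
    (ht : HasType S Φ Γ K t τ) (hN : t.size ≤ N) {ρ : Fin φ → ℕ} (hρ : Φ.Holds S ρ) {k W : ℕ}
    (hk : k ∈ K.eval S ρ) {ξ : Env} (hΓ : Γ.Realizes S N ρ W ξ) :
    RealizesTm S N τ ρ (k + W) t ξ := by
  induction ht generalizing k W ξ with
  | @ax φ Φ Γ x σ hx =>
    obtain ⟨s, w, hs, hW, hΓ⟩ := hΓ
    obtain ⟨V, hV, hσ⟩ := hΓ x σ hx
    have hwW : w x ≤ k + W := by
      by_cases hxs : x ∈ s
      · have := Finset.single_le_sum (fun y _ => Nat.zero_le (w y)) hxs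
        omega
      · simp [hs x hxs]
    refine ⟨1, k + W, V, fun π => .single (.var x ξ π V hV), ?_, hσ.mono hwW⟩
    simp only [Tm.size]
    omega
  | @subs φ Φ Γ Δ I J t σ τ ht hsub hσ hI ih =>
    obtain ⟨i, hi, k', hk', hik⟩ := hI ρ hρ
    obtain rfl := Part.mem_unique hk hk'
    obtain ⟨n, w', V, hV, hn, hR⟩ := ih hN hρ hi (hsub.realizes hρ hΓ)
    exact ⟨n, w', V, hV, hn.trans (by gcongr), hσ.realizes hρ hR⟩
  | @lam φ Φ Γ Ξ I K x t σ τ ht hΞ ih =>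
    obtain ⟨i, hi, _, hs, rfl⟩ := Idx.mem_eval_add.mp hk
    obtain ⟨i', hi', g, hg, rfl⟩ := Idx.mem_eval_sum.mp hs
    obtain rfl := Part.mem_unique hi hi'
    obtain ⟨f, hf, hΓ'⟩ := hΞ.split hi hΓ
    simp only [Tm.size] at hN
    -- Each copy holds one unit for entering the body, the weight of the body, and its share of the
    -- environment.
    refine Ty.Realizes.toTm (v := .lam x t)
      ⟨i, hi, fun a => 1 + (g a + f a), ?_, fun a ha => ?_⟩
    · simp only [Finset.sum_add_distrib, Finset.sum_const, Finset.card_range, smul_eq_mul]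
      omega
    · intro w' U hU
      obtain ⟨n, w'', V, hV, hn, hR⟩ :=
        ih (by omega) (hρ.bind hi ha) (hg a ha) ((hΓ' a ha).extend hU x)
      refine ⟨1 + n, w'', V, .lam hV, ?_, hR⟩
      have e : N * (1 + (g a + f a) + w') = N + N * (g a + (f a + w')) := by ring
      rw [e]
      omega
  | @app φ Φ Γ Δ Ξ K H t u σ τ ht hu hΞ iht ihu =>
    obtain ⟨k₁, hk₁, k₂, hk₂, rfl⟩ := Idx.mem_eval_add.mp hk
    obtain ⟨W₁, W₂, hW, h₁, h₂⟩ := hΞ.split hΓ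
    simp only [Tm.size] at hN
    obtain ⟨l, v, V, hV, hl, hR⟩ := iht (by omega) hρ hk₁ h₁
    obtain ⟨m, w, U, hU, hm, hU'⟩ := ihu (by omega) hρ hk₂ h₂
    obtain ⟨_, ⟨_, rfl⟩, f, hf, hA⟩ := hR
    have hf : f 0 ≤ v := by simpa [Idx.eval] using hf
    obtain ⟨n, w'', X, hX, hn, hX'⟩ :=
      hA 0 (by simp [Idx.eval]) w U ((σ.realizes_inst (Part.mem_some 0) w U).mp hU')
    refine ⟨_, w'', X, .app hV hU hX, ?_, (τ.realizes_inst (Part.mem_some 0) _ _).mpr hX'⟩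
    have e₁ : N * (f 0 + w) ≤ N * v + N * w := by rw [← mul_add]; gcongr
    have e₂ : N * (k₁ + W₁) + N * (k₂ + W₂) ≤ N * (k₁ + k₂ + W) := by
      rw [← mul_add]; exact Nat.mul_le_mul_left _ (by omega)
    simp only [Tm.size]
    omega
  | @ifz φ Φ Γ Δ Ξ M P J K t u s τ ht hu hs hΞ iht ihu ihs =>
    obtain ⟨k₁, hk₁, k₂, hk₂, rfl⟩ := Idx.mem_eval_add.mp hk
    obtain ⟨W₁, W₂, hW, h₁, h₂⟩ := hΞ.split hΓ
    simp only [Tm.size] at hN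
    obtain ⟨l, v, ⟨V, η⟩, hV, hl, i, hi, j, hj, m, hm, him, hmj⟩ := iht (by omega) hρ hk₁ h₁
    obtain rfl : V = .num m := hm
    have e : N * (k₁ + W₁) + N * (k₂ + W₂) ≤ N * (k₁ + k₂ + W) := by
      rw [← mul_add]; exact Nat.mul_le_mul_left _ (by omega)
    rcases m with _ | m
    · have hc : Constraint.Holds S ⟨J, .zero⟩ ρ := ⟨i, hi, 0, Part.mem_some 0, him⟩
      obtain ⟨n, w, X, hX, hn, hR⟩ := ihu (by omega) (.cons hc hρ) hk₂ h₂
      refine ⟨1 + (l + (1 + n)), w, X, fun π => ?_, ?_, hR⟩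
      · exact (Steps.single (.ifz t u s ξ π)).trans <| (hV _).trans <|
          (Steps.single (.forkZero u s η ξ π)).trans (hX π)
      · simp only [Tm.size]
        omega
    · have hc : Constraint.Holds S ⟨.one, K⟩ ρ := ⟨1, Part.mem_some 1, j, hj, by omega⟩
      obtain ⟨n, w, X, hX, hn, hR⟩ := ihs (by omega) (.cons hc hρ) hk₂ h₂
      refine ⟨1 + (l + (1 + n)), w, X, fun π => ?_, ?_, hR⟩
      · exact (Steps.single (.ifz t u s ξ π)).trans <| (hV _).trans <|
          (Steps.single (.forkSucc m u s η ξ π)).trans (hX π)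
      · simp only [Tm.size]
        omega
  | @num φ Φ Γ n =>
    have h : n ∈ (Idx.num n : Idx Θ φ).eval S ρ := by simp [Idx.eval_num]
    exact Ty.Realizes.toTm (v := .num n) ⟨n, h, n, h, n, rfl, le_rfl, le_rfl⟩
  | @succ φ Φ Γ M I J t ht ih =>
    simp only [Tm.size] at hN
    obtain ⟨l, v, ⟨V, η⟩, hV, hl, i, hi, j, hj, m, hm, him, hmj⟩ := ih (by omega) hρ hk hΓ
    obtain rfl : V = .num m := hm
    refine ⟨1 + (l + 1), v, ⟨.num (m + 1), .nil⟩, fun π => ?_, ?_, ?_⟩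
    · exact (Steps.single (.succ t ξ π)).trans <| (hV _).trans (.single (.succNum m η π))
    · simp only [Tm.size]
      omega
    · exact ⟨_, Idx.mem_eval_add.mpr ⟨i, hi, 1, Part.mem_some 1, rfl⟩,
        _, Idx.mem_eval_add.mpr ⟨j, hj, 1, Part.mem_some 1, rfl⟩, _, rfl, by omega, by omega⟩
  | @pred φ Φ Γ M I J t ht ih =>
    simp only [Tm.size] at hN
    obtain ⟨l, v, ⟨V, η⟩, hV, hl, i, hi, j, hj, m, hm, him, hmj⟩ := ih (by omega) hρ hk hΓ
    obtain rfl : V = .num m := hm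
    refine ⟨1 + (l + 1), v, ⟨.num (m - 1), .nil⟩, fun π => ?_, ?_, ?_⟩
    · exact (Steps.single (.pred t ξ π)).trans <| (hV _).trans (.single (.predNum m η π))
    · simp only [Tm.size]
      omega
    · exact ⟨_, Idx.mem_eval_monus.mpr ⟨i, hi, 1, Part.mem_some 1, rfl⟩,
        _, Idx.mem_eval_monus.mpr ⟨j, hj, 1, Part.mem_some 1, rfl⟩, _, rfl, by omega, by omega⟩
  | @fix φ Φ Γ Ξ K H I J A B x t hH ht hB hΞ ih =>
    obtain ⟨h, hh, _, hs, rfl⟩ := Idx.mem_eval_add.mp hk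
    obtain ⟨h', hh', g, hg, rfl⟩ := Idx.mem_eval_sum.mp hs
    obtain rfl := Part.mem_unique hh hh'
    obtain ⟨f, hf, hΓ'⟩ := hΞ.split hh hΓ
    have hF := hh
    rw [hH] at hF
    obtain ⟨_, ⟨_, rfl⟩, k, hk, hF⟩ := Idx.mem_eval_forest.mp hF
    simp only [Idx.eval, Part.get_some] at hF
    simp only [Tm.size] at hN
    -- The own budget of a node `b` pays for one unfolding: one unit for the body, the weight of the
    -- body, and the share of the environment.
    obtain ⟨F, hFs, hFr⟩ := realizes_of_forest (h := h) (c := fun b => 1 + (g b + f b))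
      (P := fun b w => (B.inst .zero).Realizes S N (Fin.cons b ρ) w ⟨.fix x t, ξ⟩)
      (fun b hb m hm F hF => by
        have hx : (Ty.bang I A).Realizes S N (Fin.cons b ρ) (∑ a ∈ Finset.range m, F a)
            ⟨.fix x t, ξ⟩ := by
          refine ⟨m, hm, F, le_rfl, fun a ha => ?_⟩
          obtain ⟨y, hy, hR⟩ := hF a ha
          refine hB.realizes ?_ ((Ty.realizes_subst _ (fun c => ?_) _ _).mpr hR)
          · refine .cons (Constraint.holds_lt (Part.mem_some a) (by simpa using hm) ha) ?_
            exact .cons (Constraint.holds_lt (i := b) (Part.mem_some b) (by simpa using hh) hb)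
              ((hρ.wk b).wk a)
          · refine Fin.cases ?_ (fun c => rfl) c
            refine Part.eq_some_iff.mpr (Idx.mem_eval_add.mpr ⟨y + b, ?_, 1, Part.mem_some 1, ?_⟩)
            · refine Idx.mem_eval_add.mpr ⟨y, ?_, b, Part.mem_some b, rfl⟩
              refine Idx.mem_eval_forest.mpr ⟨b + 1, ?_, a, Part.mem_some a, ?_⟩
              · exact Idx.mem_eval_add.mpr ⟨b, Part.mem_some b, 1, Part.mem_some 1, rfl⟩
              · simpa [Idx.eval_rename, cons_liftRen] using hy
            · simp only [Fin.cons_zero]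
              omega
        obtain ⟨n, v, V, hV, hn, _, ⟨_, rfl⟩, q, hq, hR⟩ :=
          ih (by omega) (hρ.bind hh hb) (hg b hb) ((hΓ' b hb).extend hx x)
        have hq : q 0 ≤ v := by simpa [Idx.eval] using hq
        have hR := (B.realizes_inst (I := .zero) (Part.mem_some 0) _ _).mpr
          (hR 0 (by simp [Idx.eval]))
        -- A linear type is an arrow, but the index of the family has to be freed to see it.
        revert hR
        generalize B.inst .zero = C
        intro hR
        cases C with
        | arrow σ τ =>
          intro w' U hU
          obtain ⟨l, w'', X, hX, hl, hX'⟩ := hR w' U hU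
          refine ⟨_, w'', X, .fix hV hX, ?_, hX'⟩
          have e₁ : N * (q 0 + w') ≤ N * v + N * w' := by rw [← mul_add]; gcongr
          have e₂ : N * (1 + (g b + f b) + ∑ a ∈ Finset.range m, F a + w') =
            N + N * (g b + (f b + ∑ a ∈ Finset.range m, F a)) + N * w' := by ring
          omega)
      hF (by omega)
    refine Ty.Realizes.toTm (v := .fix x t) ⟨k, hk, F, ?_, fun a ha => ?_⟩
    · simp only [zero_add, Finset.sum_add_distrib, Finset.sum_const, Finset.card_range,
        smul_eq_mul] at hFs
      omega
    · obtain ⟨y, hy, hR⟩ := hFr a ha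
      rw [zero_add] at hR
      refine (Ty.realizes_subst _ (fun c => ?_) _ _).mpr hR
      refine Fin.cases ?_ (fun c => rfl) c
      refine Part.eq_some_iff.mpr
        (Idx.mem_eval_forest.mpr ⟨0, Part.mem_some 0, a, Part.mem_some a, ?_⟩)
      simpa [Idx.eval_rename, cons_liftRen] using hy

end DLPCF

theorem mainTheorem1 {Θ : DLPCF.Signature} (E : DLPCF.EqProgram Θ) (S : DLPCF.Interp Θ)
    (hS : S.Models E) (t : DLPCF.Tm) (H I J : DLPCF.Idx Θ 0)
    (ht : DLPCF.HasType S [] DLPCF.Ctx.empty H t (.nat I J))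
    (h : ℕ) (hH : h ∈ H.eval S Fin.elim0) :
    ∃ n m i j : ℕ, DLPCF.EvalsIn t n m ∧ n ≤ t.size * (h + 1) ∧
      i ∈ I.eval S Fin.elim0 ∧ j ∈ J.eval S Fin.elim0 ∧ i ≤ m ∧ m ≤ j := by
  obtain ⟨n, w, ⟨V, η⟩, hV, hn, i, hi, j, hj, m, hm, him, hmj⟩ :=
    ht.sound le_rfl (fun _ hc => nomatch hc) hH (DLPCF.Ctx.realizes_empty _ .nil)
  obtain rfl : V = .num m := hm
  refine ⟨n, m, i, j, ⟨η, hV .nil⟩, ?_, hi, hj, him, hmj⟩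
  rw [mul_add, mul_one]
  exact (Nat.le_add_right _ _).trans hn
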